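/- Let $G=\mathrm{PSL}(2,\mathbb R)$, acting on the upper half-plane $\mathbb H$ by Möbius transformations, let $\tilde G\to G$ be its universal covering group with centre $Z(\tilde G)$, and for a positive integer $m$ let $G_m=\tilde G/(m\cdot Z(\tilde G))$ be the $m$-fold covering group of $G$, where $m\cdot Z(\tilde G)=\{z^m : z\in Z(\tilde G)\}$. **Levels.** Let $u\in\tilde G$ be the end point of the lift, starting at the identity, of the path $s\mapsto\rho(2\pi s)$, $0\le s\le 1$, where $\rho(\varphi)=\left[\begin{smallmatrix}\cos\frac{\varphi}{2}&\sin\frac{\varphi}{2}\\-\sin\frac{\varphi}{2}&\cos\frac{\varphi}{2}\end{smallmatrix}\right]$ is the counterclockwise rotation of $\mathbb H$ through the angle $\varphi$ about $i$; $u$ generates $Z(\tilde G)$. Let $\Xi\subset G$ be the set of all hyperbolic and parabolic elements together with the identity. An element of $\tilde G$ with hyperbolic or parabolic image in $G$ has level $k\in\mathbb Z$ if it lies in the same connected component of the preimage of $\Xi$ in $\tilde G$ as $u^k$. The level $\mathrm{lev}_m(x)\in\mathbb Z/m\mathbb Z$ of an element $x\in G_m$ with hyperbolic or parabolic image is the level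 modulo $m$ of any of its representatives in $\tilde G$. **Sequential sets.** For real $\alpha<\beta$ and $\lambda>1$, the element $\tau_{\alpha,\beta}(\lambda)=\left[\frac{1}{(\alpha-\beta)\sqrt\lambda}\left(\begin{smallmatrix}\lambda\alpha-\beta&-(\lambda-1)\alpha\beta\\ \lambda-1&\alpha-\lambda\beta\end{smallmatrix}\right)\right]$ is called positive (it is hyperbolic with attracting fixed point $\alpha$ and repelling fixed point $\beta$). For real $\alpha$ and $\lambda>0$, the parabolic element $\pi_\alpha(\lambda)=\left[\begin{smallmatrix}1-\lambda\alpha&\lambda\alpha^2\\-\lambda&1+\lambda\alpha\end{smallmatrix}\right]$ is called positive. A triple $(C_1,C_2,C_3)$ of hyperbolic or parabolic elements of $G$ is sequential if $C_1C_2C_3=1$ and for some $A\in G$ the elements $\tilde C_i=AC_iA^{-1}$ are positive, with finite fixed points, and every fixed point of $\tilde C_1$ is smaller than every fixed point of $\tilde C_2$, and every fixed point of $\tilde C_2$ is smaller than every fixed point of $\tilde C_3$. A tuple $(C_1,\dots,C_N)$ in $G$ with $N=l_h+l_p$ is a sequential set of type $(0,l_h,l_p)$ if $C_1,\dots,C_{l_h}$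 are hyperbolic, $C_{l_h+1},\dots,C_N$ are parabolic, and the triple $(C_1\cdots C_{j-1},\,C_j,\,C_{j+1}\cdots C_N)$ is sequential for every $j\in\{2,\dots,N-1\}$. With $n=g+l_h+l_p$, a tuple $(A_1,\dots,A_g,B_1,\dots,B_g,C_{g+1},\dots,C_n)$ in $G$ is a sequential set of type $(g,l_h,l_p)$ if all $A_i$, $B_i$ and $C_{g+1},\dots,C_{g+l_h}$ are hyperbolic, $C_{g+l_h+1},\dots,C_n$ are parabolic, and $(A_1,B_1A_1^{-1}B_1^{-1},\dots,A_g,B_gA_g^{-1}B_g^{-1},C_{g+1},\dots,C_n)$ is a sequential set of type $(0,2g+l_h,l_p)$. **Statement.** Let $m\ge 1$, let $g,l_h,l_p\ge 0$ be integers with $2g+l_h+l_p\ge 3$, and put $n=g+l_h+l_p$. Let $A_i,B_i$ $(i=1,\dots,g)$ and $C_i$ $(i=g+1,\dots,n)$ be elements of $G_m$ whose images in $G$ form a sequential set of type $(g,l_h,l_p)$. Then $$\prod_{i=1}^g[A_i,B_i]\cdot\prod_{i=g+1}^n C_i=e\quad\text{in }G_m$$ (where $[A,B]=ABA^{-1}B^{-1}$)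 if and only if $$\sum_{i=g+1}^n\mathrm{lev}_m(C_i)=(2-2g)-(n-g)\quad\text{in }\mathbb Z/m\mathbb Z.$$ In particular, for $n=g$ the relation holds if and only if $2-2g\equiv 0\pmod m$. -/

import Mathlib

open scoped MatrixGroups unitInterval

noncomputable section

namespace LevelLift

/-! ### The universal covering group of a topological group -/

section UniversalCover

variable (H : Type*) [Group H] [TopologicalSpace H] [IsTopologicalGroup H]

/-- The group, under pointwise multiplication, of all paths in `H` that start at `1`. -/
def PathGroup : Subgroup C(I, H) where
  carrier := {γ | γ 0 = 1}
  mul_mem' := by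
    intro a b ha hb
    simp only [Set.mem_ofPred_eq] at ha hb ⊢
    simp [ha, hb]
  one_mem' := by simp
  inv_mem' := by
    intro a ha
    simp only [Set.mem_ofPred_eq] at ha ⊢
    simp [ha]

variable {H} in
theorem homotopicRel_mul {f₀ f₁ g₀ g₁ : C(I, H)} {S : Set I}
    (hf : f₀.HomotopicRel f₁ S) (hg : g₀.HomotopicRel g₁ S) :
    (f₀ * g₀).HomotopicRel (f₁ * g₁) S := by
  obtain ⟨F⟩ := hf
  obtain ⟨G⟩ := hg
  exact ⟨(F.prod G).compContinuousMap (⟨fun p : H × H => p.1 * p.2, continuous_mul⟩ : C(H × H, H))⟩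

variable {H} in
theorem homotopicRel_inv {f₀ f₁ : C(I, H)} {S : Set I}
    (hf : f₀.HomotopicRel f₁ S) : (f₀⁻¹).HomotopicRel (f₁⁻¹) S := by
  obtain ⟨F⟩ := hf
  exact ⟨F.compContinuousMap (⟨fun p : H => p⁻¹, continuous_inv⟩ : C(H, H))⟩

/-- The subgroup of the loops at `1` that are homotopic, relative to the end points, to the
constant path. Two paths `γ`, `γ'` starting at `1` are homotopic relative to the end points if and
only if `γ⁻¹ * γ'` lies in this subgroup. -/
def NullLoops : Subgroup (PathGroup H) where
  carrier := {γ | (γ : C(I, H)).HomotopicRel 1 {0, 1}}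
  mul_mem' := by
    intro a b ha hb
    simpa using homotopicRel_mul ha hb
  one_mem' := ContinuousMap.HomotopicRel.refl _
  inv_mem' := by
    intro a ha
    simpa using homotopicRel_inv ha

instance : (NullLoops H).Normal where
  conj_mem := by
    intro n hn g
    have h := homotopicRel_mul (homotopicRel_mul
      (ContinuousMap.HomotopicRel.refl (S := {0, 1}) (g : C(I, H))) hn)
      (ContinuousMap.HomotopicRel.refl (S := {0, 1}) ((g : C(I, H))⁻¹))
    simpa [NullLoops] using h

/-- The universal covering group of `H` (for `H` connected and locally nice, such as a connected
Lie group): homotopy classes, relative to the end points, of paths starting at `1`, multiplied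
pointwise. -/
abbrev UniversalCover : Type _ := PathGroup H ⧸ NullLoops H

/-- The end point of a path, as a homomorphism. -/
def endpointHom : PathGroup H →* H where
  toFun γ := (γ : C(I, H)) 1
  map_one' := by simp
  map_mul' := by intro a b; simp

/-- The covering homomorphism: the class of a path is sent to the end point of the path. -/
def UniversalCover.proj : UniversalCover H →* H :=
  QuotientGroup.lift (NullLoops H) (endpointHom H) (by
    intro γ hγ
    have h : (γ : C(I, H)) 1 = (1 : C(I, H)) 1 :=
      ContinuousMap.HomotopicRel.fst_eq_snd hγ (by simp)
    exact h)

end UniversalCover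

/-! ### The group `G = PSL(2, ℝ)` and its elements -/

/-- `G = PSL(2, ℝ)`, with the quotient topology. -/
abbrev G : Type := PSL(2, ℝ)

/-- The class in `G` of a matrix of determinant `1`. -/
def cls (A : SL(2, ℝ)) : G := QuotientGroup.mk A

def IsHyperbolic (x : G) : Prop := ∃ A : SL(2, ℝ), cls A = x ∧ A.val.IsHyperbolic

/-- The identity is not parabolic. -/
def IsParabolic (x : G) : Prop := ∃ A : SL(2, ℝ), cls A = x ∧ A.val.IsParabolic

/-- The hyperbolic element `τ_{α,β}(l)` with real fixed points `α ≠ β`. -/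
def tau (α β l : ℝ) (h : α ≠ β) (hl : 0 < l) : G :=
  cls ⟨(1 / ((α - β) * √l)) • !![l * α - β, -((l - 1) * α * β); l - 1, α - l * β], by
    have h1 : α - β ≠ 0 := sub_ne_zero.mpr h
    have h2 : √l ≠ 0 := (Real.sqrt_pos.mpr hl).ne'
    have h3 : √l ^ 2 = l := Real.sq_sqrt hl.le
    rw [Matrix.det_smul, Matrix.det_fin_two_of]
    simp only [Fintype.card_fin]
    field_simp
    rw [h3]
    ring⟩

/-- The parabolic element `π_α(l)` with real fixed point `α`. -/
def par (α l : ℝ) : G :=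
  cls ⟨!![1 - l * α, l * α ^ 2; -l, 1 + l * α], by
    rw [Matrix.det_fin_two_of]
    ring⟩

/-- `x` is hyperbolic or parabolic with finite fixed points, and positive: `x = τ_{α,β}(l)` with
`l > 1`, `α < β`, or `x = π_α(l)` with `l > 0`. -/
def IsPositive (x : G) : Prop :=
  (∃ (α β l : ℝ) (h : α < β) (hl : 1 < l), x = tau α β l h.ne (zero_lt_one.trans hl)) ∨
    ∃ α l : ℝ, 0 < l ∧ x = par α l

/-- The real number `t` is a fixed point of the Möbius transformation `x`. (The denominator
`c t + d` cannot vanish when the equation holds.) -/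
def FixesReal (x : G) (t : ℝ) : Prop :=
  ∃ A : SL(2, ℝ), cls A = x ∧ A.val 0 0 * t + A.val 0 1 = t * (A.val 1 0 * t + A.val 1 1)

/-- All fixed points of `x` are smaller than all fixed points of `y`. -/
def FixLT (x y : G) : Prop := ∀ s t : ℝ, FixesReal x s → FixesReal y t → s < t

/-! ### Sequential sets -/

/-- A triple of hyperbolic or parabolic elements with product `1` that becomes, after a
simultaneous conjugation, a triple of positive elements with finite fixed points in increasing
order. -/
def IsSequentialTriple (C₁ C₂ C₃ : G) : Prop :=
  C₁ * C₂ * C₃ = 1 ∧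
    ∃ A : G, IsPositive (A * C₁ * A⁻¹) ∧ IsPositive (A * C₂ * A⁻¹) ∧ IsPositive (A * C₃ * A⁻¹) ∧
      FixLT (A * C₁ * A⁻¹) (A * C₂ * A⁻¹) ∧ FixLT (A * C₂ * A⁻¹) (A * C₃ * A⁻¹)

/-- Sequential sets of type `(0, lh, lp)`: the tuple `C = (C₁, …, Cₙ)`, `n = lh + lp`, has its
first `lh` members hyperbolic and the others parabolic, and
`(C₁ ⋯ C_{j-1}, C_j, C_{j+1} ⋯ Cₙ)` is a sequential triple for every `1 < j < n`. -/
def IsSequentialGenusZero (lh lp : ℕ) (C : List G) : Prop :=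
  C.length = lh + lp ∧ (∀ x ∈ C.take lh, IsHyperbolic x) ∧ (∀ x ∈ C.drop lh, IsParabolic x) ∧
    ∀ (L : List G) (x : G) (R : List G), C = L ++ x :: R → L ≠ [] → R ≠ [] →
      IsSequentialTriple L.prod x R.prod

/-- Sequential sets of type `(g, lh, lp)`. -/
def IsSequential (g lh lp : ℕ) (A B : Fin g → G) (C : Fin (lh + lp) → G) : Prop :=
  (∀ i, IsHyperbolic (A i)) ∧ (∀ i, IsHyperbolic (B i)) ∧
    (∀ i : Fin (lh + lp), (i : ℕ) < lh → IsHyperbolic (C i)) ∧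
    (∀ i : Fin (lh + lp), lh ≤ (i : ℕ) → IsParabolic (C i)) ∧
    IsSequentialGenusZero (2 * g + lh) lp
      ((List.ofFn fun i => [A i, B i * (A i)⁻¹ * (B i)⁻¹]).flatten ++ List.ofFn C)

/-! ### The universal cover `G̃`, its central element `u`, and the coverings `G_m` -/

/-- The universal covering group of `PSL(2, ℝ)`. -/
abbrev Gtilde : Type := UniversalCover G

/-- The matrix inducing the (counterclockwise) rotation of the upper half-plane through the angle
`φ` about the point `i`. -/
def rotMatrix (φ : ℝ) : SL(2, ℝ) :=
  ⟨!![Real.cos (φ / 2), Real.sin (φ / 2); -Real.sin (φ / 2), Real.cos (φ / 2)], by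
    rw [Matrix.det_fin_two_of]
    nlinarith [Real.sin_sq_add_cos_sq (φ / 2)]⟩

theorem continuous_cls : Continuous cls := continuous_quot_mk

theorem continuous_rotMatrix : Continuous rotMatrix := by
  refine Continuous.subtype_mk ?_ _
  refine continuous_matrix ?_
  intro i j
  fin_cases i <;> fin_cases j <;> simp <;> fun_prop

/-- The path `s ↦ ρ_i(2πs)`, `0 ≤ s ≤ 1`, in `G`. -/
def fullTurn : PathGroup G :=
  ⟨⟨fun s => cls (rotMatrix (2 * Real.pi * s)),
    continuous_cls.comp (continuous_rotMatrix.comp (by fun_prop))⟩, by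
    change cls (rotMatrix (2 * Real.pi * ((0 : I) : ℝ))) = 1
    have : rotMatrix (2 * Real.pi * ((0 : I) : ℝ)) = 1 := by
      ext i j
      fin_cases i <;> fin_cases j <;> simp [rotMatrix]
    rw [this]
    rfl⟩

/-- The generator `u` of the centre of `G̃`: the lift to `G̃` of the rotation through `2π`. -/
def u : Gtilde := QuotientGroup.mk fullTurn

/-- The set `Ξ` of all hyperbolic and parabolic elements of `G`, with the identity. -/
def Xi : Set G := {x | IsHyperbolic x ∨ IsParabolic x ∨ x = 1}

/-- `x` lies in the same component of the preimage of `Ξ` in `G̃` as `u ^ k`, i.e. some path in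
this preimage leads from `u ^ k` to `x`. Such a path is the lift starting at `u ^ k` of a path `γ`
in `Ξ` from `1` to the image of `x`, and the end point of this lift is the class of `γ` times
`u ^ k`. -/
def AtLevel (x : Gtilde) (k : ℤ) : Prop :=
  ∃ γ : PathGroup G, (∀ s : I, (γ : C(I, G)) s ∈ Xi) ∧ x = QuotientGroup.mk γ * u ^ k

open Classical in
/-- The level function `s` on `G̃`; meaningful for hyperbolic and parabolic elements. -/
def level (x : Gtilde) : ℤ := if h : ∃ k, AtLevel x k then h.choose else 0

/-- The subgroup `m · Z(G̃)` of the `m`-th powers of the central elements of `G̃`. -/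
def mCenter (m : ℕ) : Subgroup Gtilde where
  carrier := {x | ∃ z ∈ Subgroup.center Gtilde, z ^ m = x}
  mul_mem' := by
    rintro _ _ ⟨y, hy, rfl⟩ ⟨z, hz, rfl⟩
    have h : Commute y z := Subgroup.mem_center_iff.mp hz y
    exact ⟨y * z, mul_mem hy hz, h.mul_pow m⟩
  one_mem' := ⟨1, one_mem _, one_pow m⟩
  inv_mem' := by
    rintro _ ⟨z, hz, rfl⟩
    exact ⟨z⁻¹, inv_mem hz, inv_pow z m⟩

theorem mCenter_le_center (m : ℕ) : mCenter m ≤ Subgroup.center Gtilde := by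
  rintro x ⟨z, hz, rfl⟩
  exact pow_mem hz m

instance (m : ℕ) : (mCenter m).Normal where
  conj_mem := by
    intro n hn g
    have h := Subgroup.mem_center_iff.mp (mCenter_le_center m hn) g
    rw [h]
    simpa using hn

/-- The `m`-fold covering group `G_m = G̃ / (m · Z(G̃))` of `G`. -/
abbrev Gm (m : ℕ) : Type := Gtilde ⧸ mCenter m

theorem cls_mem_range (f : ℝ → SL(2, ℝ)) (hf : Continuous f) (h0 : f 0 = 1) :
    ∃ x : Gtilde, UniversalCover.proj G x = cls (f 1) := by
  refine ⟨QuotientGroup.mk ⟨⟨fun s => cls (f s),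
    continuous_cls.comp (hf.comp (by fun_prop))⟩, ?_⟩, ?_⟩
  · change cls (f ((0 : I) : ℝ)) = 1
    simp only [Set.Icc.coe_zero, h0]
    rfl
  · change cls (f ((1 : I) : ℝ)) = cls (f 1)
    simp

theorem val_eq_or_of_cls_eq {A B : SL(2, ℝ)} (h : cls A = cls B) :
    B.val = A.val ∨ B.val = -A.val := by
  have h1 : A⁻¹ * B ∈ Subgroup.center SL(2, ℝ) := QuotientGroup.eq.mp h
  obtain ⟨r, hr, hr'⟩ := Matrix.SpecialLinearGroup.mem_center_iff.mp h1
  have hB : B.val = A.val * (A⁻¹ * B).val := by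
    rw [← Matrix.SpecialLinearGroup.coe_mul]
    simp
  have hr2 : r ^ 2 = 1 := by simpa using hr
  rw [← hr'] at hB
  rcases (by grind : r = 1 ∨ r = -1) with h | h
  · left; simpa [h] using hB
  · right
    rw [hB, h, map_neg, map_one, mul_neg, mul_one]

theorem center_le_ker : Subgroup.center Gtilde ≤ (UniversalCover.proj G).ker := by
  intro z hz
  obtain ⟨A, hA⟩ : ∃ A : SL(2, ℝ), cls A = UniversalCover.proj G z :=
    QuotientGroup.mk_surjective _
  have key : ∀ f : ℝ → SL(2, ℝ), Continuous f → f 0 = 1 →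
      (f 1).val * A.val = A.val * (f 1).val ∨ (f 1).val * A.val = -(A.val * (f 1).val) := by
    intro f hf h0
    obtain ⟨x, hx⟩ := cls_mem_range f hf h0
    have h := congrArg (UniversalCover.proj G) (Subgroup.mem_center_iff.mp hz x)
    rw [map_mul, map_mul, hx, ← hA] at h
    have h2 := val_eq_or_of_cls_eq (A := A * f 1) (B := f 1 * A) h.symm
    simpa only [Matrix.SpecialLinearGroup.coe_mul] using h2
  have hdet : A.val 0 0 * A.val 1 1 - A.val 0 1 * A.val 1 0 = 1 := by
    rw [← Matrix.det_fin_two]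
    exact A.2
  have hU := key (fun s => ⟨!![1, s; 0, 1], by simp [Matrix.det_fin_two_of]⟩)
    (by
      refine Continuous.subtype_mk (continuous_matrix fun i j => ?_) _
      fin_cases i <;> fin_cases j <;> simp <;> fun_prop)
    (by ext i j; fin_cases i <;> fin_cases j <;> simp)
  have hL := key (fun s => ⟨!![1, 0; s, 1], by simp [Matrix.det_fin_two_of]⟩)
    (by
      refine Continuous.subtype_mk (continuous_matrix fun i j => ?_) _
      fin_cases i <;> fin_cases j <;> simp <;> fun_prop)
    (by ext i j; fin_cases i <;> fin_cases j <;> simp)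
  simp only [← Matrix.ext_iff, Fin.forall_fin_two, Matrix.mul_apply, Fin.sum_univ_two, Matrix.neg_apply, Matrix.of_apply,
    Matrix.cons_val', Matrix.cons_val_zero,
    Matrix.cons_val_one, Matrix.cons_val_fin_one] at hU hL
  have hc : A.val 1 0 = 0 := by
    rcases hU with h | h <;> grind
  have hb : A.val 0 1 = 0 := by
    rcases hL with h | h <;> grind
  have had : A.val 0 0 = A.val 1 1 := by
    rcases hU with h | h <;> grind
  rw [MonoidHom.mem_ker, ← hA]
  refine (QuotientGroup.eq_one_iff A).mpr (Matrix.SpecialLinearGroup.mem_center_iff.mpr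
    ⟨A.val 0 0, ?_, ?_⟩)
  · simp only [Fintype.card_fin]
    rw [hc, ← had] at hdet
    linarith
  · ext i j
    fin_cases i <;> fin_cases j <;> simp [hc, hb, had]

/-- The covering homomorphism `G_m → G`. -/
def Gm.proj (m : ℕ) : Gm m →* G :=
  QuotientGroup.lift (mCenter m) (UniversalCover.proj G)
    (fun _ hx => center_le_ker (mCenter_le_center m hx))

/-- The level function `lev_m` on `G_m`, with values in `ℤ/m`: the level modulo `m` of a
representative in `G̃`. -/
def lev (m : ℕ) (x : Gm m) : ZMod m := (level (Quotient.out x) : ZMod m)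

end LevelLift

end

/-!
`PSL(2, ℝ)` acts on the circle of lines of `ℝ²`, so its universal covering group acts on the line
`ℝ` covering that circle by increasing maps that commute with `t ↦ t + 1`, and `u` acts as this very
translation. By the Iwasawa decomposition the kernel of the covering homomorphism is generated by
`u`.

An element lies over `Ξ` if and only if its image fixes a point of the circle. The translation
number is continuous and takes integral values over `Ξ`; hence it is constant on the components of
the preimage of `Ξ` and equals the level there. In other words, an element of level `k` moves every
lift of a fixed point by exactly `k`.

If `x`, `y`, `z` lift a sequential triple, then `x y z = u ^ k` for some `k`. The position `0`,
which lies over `∞`, is moved by a positive element strictly further than its level, so `k` exceeds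
the sum of the levels; following a fixed point of `x` through `x`, `z`, `y` shows that `k` is less
than that sum plus two. So `k` is the sum of the levels plus one. Multiplying a sequential set
together one element at a time, each factor adds its level plus one, and the contributions of `Aᵢ`
and `Bᵢ Aᵢ⁻¹ Bᵢ⁻¹` to the levels cancel.
-/

noncomputable section

namespace LevelLift

/-! ### Null-homotopic loops and the kernel of the covering homomorphism -/

section NullLoops

variable {H : Type*} [Group H] [TopologicalSpace H] [IsTopologicalGroup H]

theorem PathGroup.apply_zero (γ : PathGroup H) : (γ : C(I, H)) 0 = 1 := γ.2

theorem UniversalCover.mk_eq_mk_of_homotopicRel {γ δ : PathGroup H}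
    (h : (γ : C(I, H)).HomotopicRel (δ : C(I, H)) {0, 1}) :
    (QuotientGroup.mk γ : UniversalCover H) = QuotientGroup.mk δ := by
  have hnull := homotopicRel_mul (.refl (S := {0, 1}) ((γ : C(I, H))⁻¹)) h
  rw [inv_mul_cancel] at hnull
  exact QuotientGroup.eq.mpr hnull.symm

theorem UniversalCover.ker_proj_le_center :
    (UniversalCover.proj H).ker ≤ Subgroup.center (UniversalCover H) := by
  intro z hz
  refine Subgroup.mem_center_iff.mpr fun x => ?_
  induction z using QuotientGroup.induction_on with | H ω =>
  induction x using QuotientGroup.induction_on with | H γ =>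
  have hω : (ω : C(I, H)) 1 = 1 := hz
  suffices h : (QuotientGroup.mk ω : UniversalCover H) = QuotientGroup.mk (γ * ω * γ⁻¹) from
    (eq_mul_inv_iff_mul_eq.mp h).symm
  -- Conjugating a loop by `γ (τ s)` moves neither of its end points.
  refine mk_eq_mk_of_homotopicRel ⟨⟨⟨⟨fun p => (γ : C(I, H)) (p.1 * p.2) * (ω : C(I, H)) p.2 *
    ((γ : C(I, H)) (p.1 * p.2))⁻¹, by fun_prop⟩, ?_, ?_⟩, ?_⟩⟩
  · intro s
    simp [PathGroup.apply_zero]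
  · intro s
    simp
  · rintro τ s (rfl | rfl)
    · simp [PathGroup.apply_zero]
    · simp [hω]

theorem mem_nullLoops_of_eq_comp {E : Type*} [AddCommGroup E] [Module ℝ E] [TopologicalSpace E]
    [IsTopologicalAddGroup E] [ContinuousSMul ℝ E] {γ : PathGroup H} (f : C(E, H)) (g : C(I, E))
    (hγ : (γ : C(I, H)) = f.comp g) (hg : g 1 = g 0) : γ ∈ NullLoops H := by
  have hgconst : g.HomotopicRel (.const I (g 0)) {0, 1} :=
    ⟨⟨.affine g (.const I (g 0)), by rintro τ s (rfl | rfl) <;> simp [hg]⟩⟩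
  have hγconst : (1 : C(I, H)) = f.comp (.const I (g 0)) := by
    ext s
    exact (PathGroup.apply_zero γ).symm.trans (congrArg (· 0) hγ)
  change (γ : C(I, H)).HomotopicRel 1 {0, 1}
  rw [hγ, hγconst]
  exact hgconst.comp_continuousMap f

end NullLoops

section TranslationNumber

variable {X : Type*} [TopologicalSpace X] {F : X → CircleDeg1Lift}

theorem continuous_translationNumber (hF : Continuous fun p : X × ℝ => F p.1 p.2) :
    Continuous fun x => (F x).translationNumber := by
  have continuous_pow (n : ℕ) : Continuous fun x => (F x ^ n) 0 := by
    induction n with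
    | zero => exact continuous_const
    | succ n ih =>
      simp only [pow_succ', CircleDeg1Lift.mul_apply]
      exact hF.comp (continuous_id.prodMk ih)
  refine TendstoUniformly.continuous (p := Filter.atTop)
    (F := fun (n : ℕ) x => (F x ^ (n + 1)) 0 / (n + 1)) ?_
    (Filter.Frequently.of_forall fun n => (continuous_pow (n + 1)).div_const _)
  rw [Metric.tendstoUniformly_iff]
  intro ε hε
  obtain ⟨N, hN⟩ := exists_nat_one_div_lt hε
  filter_upwards [Filter.eventually_ge_atTop N] with n hn x
  have hn0 : (0 : ℝ) < n + 1 := by positivity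
  have hdist := (F x).dist_pow_map_zero_mul_translationNumber_le (n + 1)
  rw [Real.dist_eq] at hdist
  push_cast at hdist
  calc dist (F x).translationNumber ((F x ^ (n + 1)) 0 / (n + 1))
      = |(F x ^ (n + 1)) 0 - (n + 1) * (F x).translationNumber| / (n + 1) := by
        rw [dist_comm, Real.dist_eq, ← abs_of_pos hn0, ← abs_div, abs_of_pos hn0, sub_div,
          mul_div_cancel_left₀ _ hn0.ne']
    _ ≤ 1 / (n + 1) := by gcongr
    _ ≤ 1 / (N + 1) := by gcongr
    _ < ε := hN

theorem translationNumber_eq_of_forall_eq_add_int [PreconnectedSpace X]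
    (hF : Continuous fun p : X × ℝ => F p.1 p.2)
    (hint : ∀ x, ∃ t, ∃ m : ℤ, F x t = t + m) (x y : X) :
    (F x).translationNumber = (F y).translationNumber := by
  have hmaps : Set.MapsTo (fun x => (F x).translationNumber) Set.univ
      (Set.range ((↑) : ℤ → ℝ)) := fun x _ => by
    obtain ⟨t, m, h⟩ := hint x
    exact ⟨m, ((F x).translationNumber_of_eq_add_int h).symm⟩
  exact isPreconnected_univ.constant_of_mapsTo
    Int.isClosedEmbedding_coe_real.isInducing.isDiscrete_range
    (continuous_translationNumber hF).continuousOn hmaps trivial trivial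

end TranslationNumber

/-! ### The action of the universal cover on the line -/

/-- The covering `ℝ → S¹` with period `1`; `turn t` is the position after `t` full turns. -/
def turn (t : ℝ) : Circle := Circle.exp (2 * Real.pi * t)

theorem isCoveringMap_turn : IsCoveringMap turn :=
  Circle.isCoveringMap_exp.comp_homeomorph (Homeomorph.mulLeft₀ (2 * Real.pi) Real.two_pi_pos.ne')

theorem turn_add (s t : ℝ) : turn (s + t) = turn s * turn t := by
  rw [turn, mul_add, Circle.exp_add, turn, turn]

theorem turn_add_one (t : ℝ) : turn (t + 1) = turn t := by
  simp only [turn, mul_add, mul_one, Circle.exp_add_two_pi]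

theorem turn_eq_turn_iff {s t : ℝ} : turn s = turn t ↔ ∃ m : ℤ, s = t + m := by
  simp only [turn, Circle.exp_eq_exp]
  refine exists_congr fun m => ?_
  constructor <;> intro h
  · have := Real.two_pi_pos.ne'
    refine mul_left_cancel₀ this ?_
    linarith
  · rw [h]
    ring

theorem turn_surjective : Function.Surjective turn := fun z => by
  obtain ⟨φ, rfl⟩ := Circle.exp_surjective z
  exact ⟨φ / (2 * Real.pi), by rw [turn, mul_div_cancel₀ _ Real.two_pi_pos.ne']⟩

section LineAction

variable {H : Type*} [Group H] [TopologicalSpace H] [IsTopologicalGroup H] [MulAction H Circle]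
  [ContinuousSMul H Circle]

/-- The lift to `ℝ`, along `turn`, of the motion of the circle induced by the path `γ`. -/
def lineLift (γ : PathGroup H) : C(I × ℝ, ℝ) :=
  isCoveringMap_turn.liftHomotopy
    ⟨fun p => (γ : C(I, H)) p.1 • turn p.2,
      ((map_continuous _).comp continuous_fst).smul
        (isCoveringMap_turn.continuous.comp continuous_snd)⟩
    (.id ℝ) fun t => by simp [PathGroup.apply_zero]

theorem turn_lineLift (γ : PathGroup H) (s : I) (t : ℝ) :
    turn (lineLift γ (s, t)) = (γ : C(I, H)) s • turn t :=
  congrFun (isCoveringMap_turn.liftHomotopy_lifts _ _ _) (s, t)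

theorem lineLift_zero (γ : PathGroup H) (t : ℝ) : lineLift γ (0, t) = t :=
  isCoveringMap_turn.liftHomotopy_zero _ _ _ t

theorem eq_lineLift {γ : PathGroup H} {F : I → ℝ} {t : ℝ} (hF : Continuous F)
    (hlift : ∀ s, turn (F s) = (γ : C(I, H)) s • turn t) (hF0 : F 0 = t) (s : I) :
    F s = lineLift γ (s, t) :=
  congrFun (isCoveringMap_turn.eq_of_comp_eq hF (g₂ := fun s => lineLift γ (s, t)) (by fun_prop)
    (funext fun s => by simp only [Function.comp_apply, hlift, turn_lineLift]) 0
    (by simp only [hF0, lineLift_zero])) s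

theorem lineLift_one (s : I) (t : ℝ) : lineLift (1 : PathGroup H) (s, t) = t :=
  (eq_lineLift (F := fun _ => t) continuous_const (fun s => by simp) rfl s).symm

theorem lineLift_mul (γ δ : PathGroup H) (s : I) (t : ℝ) :
    lineLift (γ * δ) (s, t) = lineLift γ (s, lineLift δ (s, t)) :=
  (eq_lineLift (F := fun s => lineLift γ (s, lineLift δ (s, t))) (by fun_prop)
    (fun s => by simp [turn_lineLift, mul_smul]) (by simp [lineLift_zero]) s).symm

theorem lineLift_add_one (γ : PathGroup H) (s : I) (t : ℝ) :
    lineLift γ (s, t + 1) = lineLift γ (s, t) + 1 :=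
  (eq_lineLift (F := fun s => lineLift γ (s, t) + 1) (by fun_prop)
    (fun s => by simp only [turn_add_one, turn_lineLift]) (by simp only [lineLift_zero]) s).symm

theorem lineLift_injective (γ : PathGroup H) (s : I) :
    Function.Injective fun t => lineLift γ (s, t) :=
  Function.LeftInverse.injective (g := fun t => lineLift γ⁻¹ (s, t)) fun t => by
    simp only [← lineLift_mul, inv_mul_cancel, lineLift_one]

theorem lineLift_strictMono (γ : PathGroup H) (s : I) :
    StrictMono fun t => lineLift γ (s, t) := by
  refine (Continuous.strictMono_of_inj (by fun_prop) (lineLift_injective γ s)).resolve_right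
    fun hanti => ?_
  have hlt : lineLift γ (s, 0 + 1) < lineLift γ (s, 0) := hanti (by norm_num)
  rw [lineLift_add_one] at hlt
  linarith

theorem lineLift_eq_of_mem_nullLoops {γ : PathGroup H} (hγ : γ ∈ NullLoops H) (t : ℝ) :
    lineLift γ (1, t) = t := by
  let orbit (h : H) : Circle := h • turn t
  have hnull : ((⟨orbit, by fun_prop⟩ : C(H, Circle)).comp (γ : C(I, H))).HomotopicRel
      (.const I (turn t)) {0, 1} := by
    have := ContinuousMap.HomotopicRel.comp_continuousMap hγ (⟨orbit, by fun_prop⟩ : C(H, Circle))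
    convert this using 1
    ext s
    simp [orbit]
  have hstart : (⟨orbit, by fun_prop⟩ : C(H, Circle)).comp (γ : C(I, H)) 0 = turn t := by
    simp [orbit, PathGroup.apply_zero]
  have := isCoveringMap_turn.liftPath_apply_one_eq_of_homotopicRel hnull t hstart rfl
  rw [isCoveringMap_turn.liftPath_const rfl] at this
  exact this

/-- The lifts to `ℝ` of the circle homeomorphisms along a path. -/
def lineMap (γ : PathGroup H) (s : I) : CircleDeg1Lift where
  toFun t := lineLift γ (s, t)
  monotone' := (lineLift_strictMono γ s).monotone
  map_add_one' := lineLift_add_one γ s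

variable (H) in
/-- The action of the universal covering group of `H` on the universal cover `ℝ` of the circle. -/
def lineAction : UniversalCover H →* CircleDeg1Lift :=
  QuotientGroup.lift (NullLoops H)
    { toFun := fun γ => lineMap γ 1
      map_one' := CircleDeg1Lift.ext fun t => lineLift_one 1 t
      map_mul' := fun γ δ => CircleDeg1Lift.ext fun t => lineLift_mul γ δ 1 t }
    fun _ hγ => CircleDeg1Lift.ext fun t => lineLift_eq_of_mem_nullLoops hγ t

theorem lineAction_mk (γ : PathGroup H) :
    lineAction H (QuotientGroup.mk γ) = lineMap γ 1 := rfl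

theorem turn_lineAction (x : UniversalCover H) (t : ℝ) :
    turn (lineAction H x t) = UniversalCover.proj H x • turn t := by
  induction x using QuotientGroup.induction_on with
  | H γ => exact turn_lineLift γ 1 t

theorem lineAction_strictMono (x : UniversalCover H) : StrictMono (lineAction H x) := by
  induction x using QuotientGroup.induction_on with
  | H γ => exact lineLift_strictMono γ 1

/-- Poincaré's translation number of the action on the line. -/
def rotationNumber (x : UniversalCover H) : ℝ := (lineAction H x).translationNumber

theorem rotationNumber_one : rotationNumber (1 : UniversalCover H) = 0 := by
  rw [rotationNumber, map_one, CircleDeg1Lift.translationNumber_one]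

theorem rotationNumber_mul_of_commute {x y : UniversalCover H} (h : Commute x y) :
    rotationNumber (x * y) = rotationNumber x + rotationNumber y := by
  rw [rotationNumber, map_mul]
  exact CircleDeg1Lift.translationNumber_mul_of_commute (h.map (lineAction H))

theorem rotationNumber_inv (x : UniversalCover H) : rotationNumber x⁻¹ = -rotationNumber x := by
  have h := rotationNumber_mul_of_commute (Commute.refl x).inv_right
  rw [mul_inv_cancel, rotationNumber_one] at h
  exact eq_neg_of_add_eq_zero_right h.symm

theorem rotationNumber_conj (x y : UniversalCover H) :
    rotationNumber (y * x * y⁻¹) = rotationNumber x :=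
  (CircleDeg1Lift.translationNumber_eq_of_semiconjBy (f := lineAction H y) <| by
    rw [SemiconjBy, ← map_mul, ← map_mul, inv_mul_cancel_right]).symm

theorem rotationNumber_mk_eq_zero {γ : PathGroup H}
    (hfix : ∀ s, ∃ z : Circle, (γ : C(I, H)) s • z = z) :
    rotationNumber (QuotientGroup.mk γ : UniversalCover H) = 0 := by
  have hint (s : I) : ∃ t, ∃ m : ℤ, lineMap γ s t = t + m := by
    obtain ⟨z, hz⟩ := hfix s
    obtain ⟨t, rfl⟩ := turn_surjective z
    exact ⟨t, turn_eq_turn_iff.mp ((turn_lineLift γ s t).trans hz)⟩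
  have hstart : lineMap γ 0 = 1 := CircleDeg1Lift.ext (lineLift_zero γ)
  rw [rotationNumber, lineAction_mk,
    translationNumber_eq_of_forall_eq_add_int (F := lineMap γ) (lineLift γ).continuous hint 1 0,
    hstart, CircleDeg1Lift.translationNumber_one]

end LineAction

/-! ### The action of `PSL(2, ℝ)` on the circle of directions -/

/-- The linear action of a real matrix on `ℝ² = ℂ`. -/
def planeMap (A : Matrix (Fin 2) (Fin 2) ℝ) (w : ℂ) : ℂ :=
  ⟨A 0 0 * w.re + A 0 1 * w.im, A 1 0 * w.re + A 1 1 * w.im⟩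

theorem planeMap_one (w : ℂ) : planeMap 1 w = w := by
  simp [planeMap]

theorem planeMap_mul (A B : Matrix (Fin 2) (Fin 2) ℝ) (w : ℂ) :
    planeMap (A * B) w = planeMap A (planeMap B w) := by
  simp only [planeMap, Matrix.mul_apply, Fin.sum_univ_two]
  apply Complex.ext <;> ring

theorem planeMap_neg (A : Matrix (Fin 2) (Fin 2) ℝ) (w : ℂ) :
    planeMap (-A) w = -planeMap A w := by
  apply Complex.ext <;> simp [planeMap] <;> ring

theorem planeMap_eq_real_mul_iff {A : Matrix (Fin 2) (Fin 2) ℝ} {w v : ℂ} {r : ℝ} :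
    planeMap A w = r * v ↔ A 0 0 * w.re + A 0 1 * w.im = r * v.re ∧
      A 1 0 * w.re + A 1 1 * w.im = r * v.im := by
  rw [Complex.ext_iff, Complex.re_ofReal_mul, Complex.im_ofReal_mul, planeMap]

theorem planeMap_ne_zero (A : SL(2, ℝ)) {w : ℂ} (hw : w ≠ 0) : planeMap A.val w ≠ 0 := by
  intro h
  have hinv : planeMap (A⁻¹ * A).val w = w := by
    rw [inv_mul_cancel]
    exact planeMap_one w
  rw [Matrix.SpecialLinearGroup.coe_mul, planeMap_mul, h] at hinv
  refine hw (hinv.symm.trans ?_)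
  simp [planeMap, Complex.ext_iff]

theorem ofConjDivSelf_exp (φ : ℝ) :
    Circle.ofConjDivSelf (Circle.exp φ) (Circle.coe_ne_zero _) = Circle.exp (-(2 * φ)) := by
  refine Circle.ext ?_
  change (starRingEnd ℂ) _ / _ = _
  rw [← Circle.coe_inv_eq_conj, ← Circle.coe_div, ← Circle.exp_neg, ← Circle.exp_sub]
  ring_nf

theorem ofConjDivSelf_surjective (z : Circle) :
    ∃ w, ∃ hw : w ≠ 0, Circle.ofConjDivSelf w hw = z := by
  obtain ⟨φ, rfl⟩ := Circle.exp_surjective z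
  refine ⟨Circle.exp (-(φ / 2)), Circle.coe_ne_zero _, ?_⟩
  rw [ofConjDivSelf_exp]
  ring_nf

theorem ofConjDivSelf_real_mul {r : ℝ} {w : ℂ} (h : (r : ℂ) * w ≠ 0) :
    Circle.ofConjDivSelf (r * w) h = Circle.ofConjDivSelf w (right_ne_zero_of_mul h) := by
  refine Circle.ext ?_
  change (starRingEnd ℂ) (r * w) / (r * w) = (starRingEnd ℂ) w / w
  rw [map_mul, Complex.conj_ofReal, mul_div_mul_left _ _ (left_ne_zero_of_mul h)]

/-- The factor `A w / w` by which `A` stretches and turns a vector `w` of the plane, as a function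
of the position `z = conj w / w` of the line `ℝ w` on the circle. -/
def automorphyFactor (A : SL(2, ℝ)) (z : Circle) : ℂ :=
  ((A.val 0 0 + A.val 1 0 * Complex.I) * (1 + z) +
    (A.val 1 1 - A.val 0 1 * Complex.I) * (1 - z)) / 2

theorem automorphyFactor_mul (A : SL(2, ℝ)) {w : ℂ} (hw : w ≠ 0) :
    automorphyFactor A (Circle.ofConjDivSelf w hw) * w = planeMap A.val w := by
  have hz : (Circle.ofConjDivSelf w hw : ℂ) * w = (starRingEnd ℂ) w := div_mul_cancel₀ _ hw
  have hfactor : automorphyFactor A (Circle.ofConjDivSelf w hw) * w =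
      ((A.val 0 0 + A.val 1 0 * Complex.I) * (w + (starRingEnd ℂ) w) +
        (A.val 1 1 - A.val 0 1 * Complex.I) * (w - (starRingEnd ℂ) w)) / 2 := by
    rw [← hz, automorphyFactor]
    ring
  rw [hfactor]
  apply Complex.ext <;> simp [planeMap] <;> ring

theorem automorphyFactor_ne_zero (A : SL(2, ℝ)) (z : Circle) : automorphyFactor A z ≠ 0 := by
  obtain ⟨w, hw, rfl⟩ := ofConjDivSelf_surjective z
  refine left_ne_zero_of_mul (b := w) ?_
  rw [automorphyFactor_mul]
  exact planeMap_ne_zero A hw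

/-- The map of the circle induced by `A`, when `z = conj w / w` is identified with the line `ℝ w`;
written in terms of `z` alone, so as to be visibly continuous. -/
def circleMap (A : SL(2, ℝ)) (z : Circle) : Circle :=
  z * Circle.ofConjDivSelf (automorphyFactor A z) (automorphyFactor_ne_zero A z)

theorem circleMap_ofConjDivSelf (A : SL(2, ℝ)) {w : ℂ} (hw : w ≠ 0) :
    circleMap A (Circle.ofConjDivSelf w hw) =
      Circle.ofConjDivSelf (planeMap A.val w) (planeMap_ne_zero A hw) := by
  refine Circle.ext ?_
  change (starRingEnd ℂ) w / w * ((starRingEnd ℂ) _ / _) = (starRingEnd ℂ) _ / _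
  rw [← automorphyFactor_mul A hw, map_mul]
  field_simp

theorem circleMap_one (z : Circle) : circleMap 1 z = z := by
  obtain ⟨w, hw, rfl⟩ := ofConjDivSelf_surjective z
  rw [circleMap_ofConjDivSelf]
  congr 1
  exact planeMap_one w

theorem circleMap_mul (A B : SL(2, ℝ)) (z : Circle) :
    circleMap (A * B) z = circleMap A (circleMap B z) := by
  obtain ⟨w, hw, rfl⟩ := ofConjDivSelf_surjective z
  simp only [circleMap_ofConjDivSelf, Matrix.SpecialLinearGroup.coe_mul, planeMap_mul]

theorem circleMap_eq_of_cls_eq {A B : SL(2, ℝ)} (h : cls A = cls B) :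
    circleMap A = circleMap B := by
  funext z
  obtain ⟨w, hw, rfl⟩ := ofConjDivSelf_surjective z
  simp only [circleMap_ofConjDivSelf]
  rcases val_eq_or_of_cls_eq h with hAB | hAB
  · simp only [hAB]
  · refine Circle.ext ?_
    change (starRingEnd ℂ) _ / _ = (starRingEnd ℂ) _ / _
    rw [hAB, planeMap_neg, map_neg, neg_div_neg_eq]

theorem continuous_entry (i j : Fin 2) : Continuous fun A : SL(2, ℝ) => A.val i j :=
  (continuous_apply_apply i j).comp continuous_subtype_val

theorem continuous_circleMap : Continuous fun p : SL(2, ℝ) × Circle => circleMap p.1 p.2 := by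
  have hentry (i j : Fin 2) : Continuous fun p : SL(2, ℝ) × Circle => (p.1.val i j : ℂ) :=
    Complex.continuous_ofReal.comp ((continuous_entry i j).comp continuous_fst)
  have hpoint : Continuous fun p : SL(2, ℝ) × Circle => (p.2 : ℂ) :=
    continuous_subtype_val.comp continuous_snd
  have hfactor : Continuous fun p : SL(2, ℝ) × Circle => automorphyFactor p.1 p.2 :=
    ((((hentry 0 0).add ((hentry 1 0).mul_const _)).mul (hpoint.const_add 1)).add
      (((hentry 1 1).sub ((hentry 0 1).mul_const _)).mul (continuous_const.sub hpoint))).div_const 2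
  refine continuous_snd.mul (Continuous.subtype_mk ?_ _)
  exact (Complex.continuous_conj.comp hfactor).div hfactor fun p => automorphyFactor_ne_zero p.1 p.2

theorem cls_surjective : Function.Surjective cls := QuotientGroup.mk_surjective

theorem isOpenQuotientMap_cls : IsOpenQuotientMap cls := QuotientGroup.isOpenQuotientMap_mk

instance : MulAction G Circle where
  smul x z := Quotient.liftOn' x (circleMap · z) fun _ _ h =>
    congrFun (circleMap_eq_of_cls_eq (Quotient.sound' h)) z
  one_smul := circleMap_one
  mul_smul x y z := by
    obtain ⟨A, rfl⟩ := cls_surjective x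
    obtain ⟨B, rfl⟩ := cls_surjective y
    exact circleMap_mul A B z

theorem cls_smul (A : SL(2, ℝ)) (z : Circle) : cls A • z = circleMap A z := rfl

instance : ContinuousSMul G Circle where
  continuous_smul :=
    (isOpenQuotientMap_cls.prodMap .id).continuous_comp_iff.mp continuous_circleMap

theorem cls_smul_ofConjDivSelf (A : SL(2, ℝ)) {w : ℂ} (hw : w ≠ 0) :
    cls A • Circle.ofConjDivSelf w hw =
      Circle.ofConjDivSelf (planeMap A.val w) (planeMap_ne_zero A hw) :=
  circleMap_ofConjDivSelf A hw

theorem cls_smul_ofConjDivSelf_of_planeMap_eq {A : SL(2, ℝ)} {w : ℂ} (hw : w ≠ 0) {r : ℝ}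
    (h : planeMap A.val w = r * w) :
    cls A • Circle.ofConjDivSelf w hw = Circle.ofConjDivSelf w hw := by
  have hne : (r : ℂ) * w ≠ 0 := h ▸ planeMap_ne_zero A hw
  rw [cls_smul_ofConjDivSelf, ← ofConjDivSelf_real_mul hne]
  simp only [h]

theorem apply_one_zero_eq_zero_of_cls_smul_one {A : SL(2, ℝ)} (h : cls A • (1 : Circle) = 1) :
    A.val 1 0 = 0 := by
  have hfactor : automorphyFactor A 1 = A.val 0 0 + A.val 1 0 * Complex.I := by
    simp [automorphyFactor, one_add_one_eq_two]
  rw [cls_smul, circleMap, one_mul] at h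
  have hreal : (starRingEnd ℂ) (automorphyFactor A 1) = automorphyFactor A 1 :=
    (div_eq_one_iff_eq (automorphyFactor_ne_zero A 1)).mp (congrArg Subtype.val h)
  simpa [hfactor] using Complex.conj_eq_iff_im.mp hreal

theorem cls_rotMatrix_smul (φ : ℝ) (z : Circle) : cls (rotMatrix φ) • z = Circle.exp φ * z := by
  have hfactor : automorphyFactor (rotMatrix φ) z = Circle.exp (-(φ / 2)) := by
    rw [Circle.coe_exp, Complex.exp_mul_I, ← Complex.ofReal_cos, ← Complex.ofReal_sin,
      Real.cos_neg, Real.sin_neg]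
    simp only [automorphyFactor, rotMatrix, Matrix.of_apply, Matrix.cons_val', Matrix.cons_val_zero,
      Matrix.cons_val_one, Matrix.cons_val_fin_one]
    push_cast
    ring
  simp only [cls_smul, circleMap, hfactor, ofConjDivSelf_exp]
  rw [mul_comm]
  ring_nf

/-! ### The fundamental group of `PSL(2, ℝ)` -/

theorem cls_neg (A : SL(2, ℝ)) : cls (-A) = cls A := by
  refine QuotientGroup.eq.mpr (Matrix.SpecialLinearGroup.mem_center_iff.mpr ⟨-1, by simp, ?_⟩)
  rw [inv_neg, neg_mul, inv_mul_cancel, Matrix.SpecialLinearGroup.coe_neg,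
    Matrix.SpecialLinearGroup.coe_one, map_neg, map_one]

/-- The Gram matrix `Aᵀ A` of the columns of a representative `A`; left translation by rotations
does not change it, so it sees only the triangular factor of the Iwasawa decomposition. -/
def gram (x : G) : Matrix (Fin 2) (Fin 2) ℝ :=
  Quotient.liftOn' x (fun A => A.val.transpose * A.val) fun A B h => by
    rcases val_eq_or_of_cls_eq (Quotient.sound' h : cls A = cls B) with hAB | hAB <;> simp [hAB]

theorem gram_cls (A : SL(2, ℝ)) : gram (cls A) = A.val.transpose * A.val := rfl

theorem continuous_gram : Continuous gram :=
  isOpenQuotientMap_cls.continuous_comp_iff.mp <|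
    continuous_subtype_val.matrix_transpose.matrix_mul continuous_subtype_val

theorem gram_rotMatrix_mul (φ : ℝ) (x : G) : gram (cls (rotMatrix φ) * x) = gram x := by
  obtain ⟨A, rfl⟩ := cls_surjective x
  have horth : (rotMatrix φ).val.transpose * (rotMatrix φ).val = 1 := by
    ext i j
    fin_cases i <;> fin_cases j <;>
      simp [rotMatrix, Matrix.mul_apply, Fin.sum_univ_two] <;>
      nlinarith [Real.sin_sq_add_cos_sq (φ / 2)]
  change gram (cls (rotMatrix φ * A)) = _
  rw [gram_cls, gram_cls, Matrix.SpecialLinearGroup.coe_mul, Matrix.transpose_mul, Matrix.mul_assoc,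
    ← Matrix.mul_assoc (rotMatrix φ).val.transpose, horth, Matrix.one_mul]

/-- The upper triangular matrix whose Gram matrix has first row `eˡ (1, b)`. -/
def upper (l b : ℝ) : SL(2, ℝ) :=
  ⟨!![Real.exp (l / 2), Real.exp (l / 2) * b; 0, Real.exp (-(l / 2))], by
    rw [Matrix.det_fin_two_of, ← Real.exp_add, mul_zero, sub_zero, add_neg_cancel, Real.exp_zero]⟩

theorem continuous_upper {X : Type*} [TopologicalSpace X] {l b : X → ℝ} (hl : Continuous l)
    (hb : Continuous b) : Continuous fun x => upper (l x) (b x) := by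
  refine Continuous.subtype_mk (continuous_matrix fun i j => ?_) _
  fin_cases i <;> fin_cases j <;>
    simp only [Fin.isValue, Fin.zero_eta, Fin.mk_one, Matrix.of_apply, Matrix.cons_val',
      Matrix.cons_val_zero, Matrix.cons_val_one, Matrix.cons_val_fin_one] <;>
    fun_prop

theorem exists_cls_eq_of_smul_one {x : G} (hx : x • (1 : Circle) = 1) :
    ∃ A, cls A = x ∧ A.val 1 0 = 0 ∧ 0 < A.val 0 0 := by
  obtain ⟨A, rfl⟩ := cls_surjective x
  have hc := apply_one_zero_eq_zero_of_cls_smul_one hx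
  have hdet := A.det_coe
  rw [Matrix.det_fin_two, hc, mul_zero, sub_zero] at hdet
  rcases (left_ne_zero_of_mul_eq_one hdet).lt_or_gt with ha | ha
  · exact ⟨-A, cls_neg A, by simpa using hc, by simpa using ha⟩
  · exact ⟨A, rfl, hc, ha⟩

theorem cls_upper_gram {x : G} (hx : x • (1 : Circle) = 1) :
    cls (upper (Real.log (gram x 0 0)) (gram x 0 1 / gram x 0 0)) = x := by
  obtain ⟨A, rfl, hc, ha⟩ := exists_cls_eq_of_smul_one hx
  have hdet := A.det_coe
  rw [Matrix.det_fin_two, hc, mul_zero, sub_zero] at hdet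
  have h00 : gram (cls A) 0 0 = A.val 0 0 ^ 2 := by
    rw [gram_cls, Matrix.mul_apply, Fin.sum_univ_two]
    simp only [Matrix.transpose_apply, hc]
    ring
  have h01 : gram (cls A) 0 1 = A.val 0 0 * A.val 0 1 := by
    rw [gram_cls, Matrix.mul_apply, Fin.sum_univ_two]
    simp only [Matrix.transpose_apply, hc]
    ring
  congr 1
  ext i j
  rw [h00, h01]
  fin_cases i <;> fin_cases j
  · simp [upper, Real.exp_log ha]
  · change Real.exp (Real.log (A.val 0 0 ^ 2) / 2) * (A.val 0 0 * A.val 0 1 / A.val 0 0 ^ 2) =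
      A.val 0 1
    rw [Real.log_pow, Nat.cast_ofNat, mul_div_cancel_left₀ _ two_ne_zero, Real.exp_log ha]
    field_simp
  · simp [upper, hc]
  · simpa [upper, Real.exp_neg, Real.exp_log ha] using inv_eq_of_mul_eq_one_right hdet

theorem gram_apply_zero_zero_pos (x : G) : 0 < gram x 0 0 := by
  obtain ⟨A, rfl⟩ := cls_surjective x
  have hdet := A.det_coe
  rw [Matrix.det_fin_two] at hdet
  rw [gram_cls, Matrix.mul_apply, Fin.sum_univ_two]
  simp only [Matrix.transpose_apply]
  by_contra! hle
  have h0 : A.val 0 0 = 0 := by nlinarith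
  have h1 : A.val 1 0 = 0 := by nlinarith
  simp [h0, h1] at hdet

/-- The product of the rotation by `p.1` full turns and a triangular matrix: the Iwasawa
parametrization of `PSL(2, ℝ)` by `ℝ³`. -/
def iwasawa (p : ℝ × ℝ × ℝ) : G :=
  cls (rotMatrix (2 * Real.pi * p.1)) * cls (upper p.2.1 p.2.2)

theorem continuous_iwasawa : Continuous iwasawa :=
  (continuous_cls.comp (continuous_rotMatrix.comp (by fun_prop))).mul
    (continuous_cls.comp (continuous_upper (by fun_prop) (by fun_prop)))

theorem iwasawa_of_turn_eq {x : G} {t : ℝ} (h : turn t = x • (1 : Circle)) :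
    iwasawa (t, Real.log (gram x 0 0), gram x 0 1 / gram x 0 0) = x := by
  have hfix : ((cls (rotMatrix (2 * Real.pi * t)))⁻¹ * x) • (1 : Circle) = 1 := by
    rw [mul_smul, ← h, inv_smul_eq_iff, cls_rotMatrix_smul, mul_one, turn]
  have hgram : gram ((cls (rotMatrix (2 * Real.pi * t)))⁻¹ * x) = gram x := by
    rw [← gram_rotMatrix_mul (2 * Real.pi * t), mul_inv_cancel_left]
  have := cls_upper_gram hfix
  rw [hgram] at this
  rw [iwasawa, this, mul_inv_cancel_left]

theorem turn_zero : turn 0 = 1 := by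
  rw [turn, mul_zero, Circle.exp_zero]

theorem mem_nullLoops_of_lineLift_eq_zero {γ : PathGroup G} (hloop : (γ : C(I, G)) 1 = 1)
    (hlift : lineLift γ (1, 0) = 0) : γ ∈ NullLoops G := by
  have hgram (i j : Fin 2) : Continuous fun s => gram ((γ : C(I, G)) s) i j :=
    (continuous_apply_apply i j).comp (continuous_gram.comp (map_continuous _))
  have hpos (s : I) : gram ((γ : C(I, G)) s) 0 0 ≠ 0 := (gram_apply_zero_zero_pos _).ne'
  refine mem_nullLoops_of_eq_comp ⟨iwasawa, continuous_iwasawa⟩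
    ⟨fun s => (lineLift γ (s, 0), Real.log (gram ((γ : C(I, G)) s) 0 0),
      gram ((γ : C(I, G)) s) 0 1 / gram ((γ : C(I, G)) s) 0 0),
      .prodMk (by fun_prop) (.prodMk ((hgram 0 0).log hpos) ((hgram 0 1).div (hgram 0 0) hpos))⟩
    ?_ ?_
  · ext1 s
    exact (iwasawa_of_turn_eq ((turn_lineLift γ s 0).trans (by rw [turn_zero]))).symm
  · simp only [ContinuousMap.coe_mk, hloop, hlift, PathGroup.apply_zero, lineLift_zero]

theorem lineAction_u (t : ℝ) : lineAction G u t = t + 1 :=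
  (eq_lineLift (γ := fullTurn) (F := fun s : I => t + s) (by fun_prop)
    (fun s => by
      rw [add_comm, turn_add]
      exact (cls_rotMatrix_smul _ _).symm)
    (by simp) 1).symm

theorem lineAction_u_zpow (k : ℤ) (t : ℝ) : lineAction G (u ^ k) t = t + k := by
  induction k with
  | zero => simp
  | succ k ih =>
    rw [add_comm (k : ℤ), zpow_one_add, map_mul, CircleDeg1Lift.mul_apply, lineAction_u, ih]
    push_cast
    ring
  | pred k ih =>
    have hstep : u ^ (-(k : ℤ)) = u * u ^ (-(k : ℤ) - 1) := by
      rw [← zpow_one_add, add_sub_cancel]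
    rw [hstep, map_mul, CircleDeg1Lift.mul_apply, lineAction_u] at ih
    push_cast at ih ⊢
    linarith

theorem u_zpow_injective : Function.Injective fun k : ℤ => u ^ k := fun j k h => by
  have hact : lineAction G (u ^ j) 0 = lineAction G (u ^ k) 0 := congrArg (lineAction G · 0) h
  simpa only [lineAction_u_zpow, zero_add, Int.cast_inj] using hact

theorem proj_u : UniversalCover.proj G u = 1 := by
  have hrot : rotMatrix (2 * Real.pi * ((1 : I) : ℝ)) = -1 := by
    ext i j
    fin_cases i <;> fin_cases j <;> simp [rotMatrix]
  exact (congrArg cls hrot).trans (cls_neg 1)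

theorem proj_u_zpow (k : ℤ) : UniversalCover.proj G (u ^ k) = 1 := by
  rw [map_zpow, proj_u, one_zpow]

theorem u_zpow_mem_center (k : ℤ) : u ^ k ∈ Subgroup.center Gtilde :=
  UniversalCover.ker_proj_le_center (proj_u_zpow k)

theorem commute_u_zpow (x : Gtilde) (k : ℤ) : Commute x (u ^ k) :=
  Subgroup.mem_center_iff.mp (u_zpow_mem_center k) x

theorem exists_eq_u_zpow {x : Gtilde} (hx : UniversalCover.proj G x = 1) : ∃ k : ℤ, x = u ^ k := by
  obtain ⟨k, hk⟩ : ∃ k : ℤ, lineAction G x 0 = 0 + k :=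
    turn_eq_turn_iff.mp (by rw [turn_lineAction, hx, one_smul])
  obtain ⟨γ, hγ⟩ := QuotientGroup.mk_surjective (u ^ (-k) * x)
  have hloop : (γ : C(I, G)) 1 = 1 := by
    change UniversalCover.proj G (QuotientGroup.mk γ) = 1
    rw [hγ, map_mul, proj_u_zpow, hx, mul_one]
  have hlift : lineLift γ (1, 0) = 0 := by
    change lineAction G (QuotientGroup.mk γ) 0 = 0
    rw [hγ, map_mul, CircleDeg1Lift.mul_apply, hk, lineAction_u_zpow]
    push_cast
    ring
  have hone : u ^ (-k) * x = 1 :=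
    hγ.symm.trans ((QuotientGroup.eq_one_iff γ).mpr (mem_nullLoops_of_lineLift_eq_zero hloop hlift))
  rw [zpow_neg, inv_mul_eq_one] at hone
  exact ⟨k, hone.symm⟩

theorem rotMatrix_zero : rotMatrix 0 = 1 := by
  ext i j
  fin_cases i <;> fin_cases j <;> simp [rotMatrix]

theorem upper_zero_zero : upper 0 0 = 1 := by
  ext i j
  fin_cases i <;> fin_cases j <;> simp [upper]

theorem iwasawa_zero : iwasawa 0 = 1 := by
  simp only [iwasawa, Prod.fst_zero, Prod.snd_zero, mul_zero, rotMatrix_zero, upper_zero_zero]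
  exact mul_one (1 : G)

theorem proj_surjective : Function.Surjective (UniversalCover.proj G) := fun x => by
  obtain ⟨t, ht⟩ := turn_surjective (x • (1 : Circle))
  let p : ℝ × ℝ × ℝ := (t, Real.log (gram x 0 0), gram x 0 1 / gram x 0 0)
  refine ⟨QuotientGroup.mk ⟨⟨fun s => iwasawa ((s : ℝ) • p),
    continuous_iwasawa.comp (by fun_prop)⟩, ?_⟩, ?_⟩
  · exact (congrArg iwasawa (zero_smul ℝ p)).trans iwasawa_zero
  · exact (congrArg iwasawa (one_smul ℝ p)).trans (iwasawa_of_turn_eq ht)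

theorem u_zpow_mem_mCenter_iff {m : ℕ} {k : ℤ} : u ^ k ∈ mCenter m ↔ (m : ℤ) ∣ k := by
  constructor
  · rintro ⟨z, hz, h⟩
    obtain ⟨j, rfl⟩ := exists_eq_u_zpow (center_le_ker hz)
    rw [← zpow_natCast, ← zpow_mul] at h
    exact ⟨j, (u_zpow_injective h).symm.trans (mul_comm j m)⟩
  · rintro ⟨j, rfl⟩
    exact ⟨u ^ j, u_zpow_mem_center j, by rw [← zpow_natCast, ← zpow_mul, mul_comm]⟩

theorem rotationNumber_u_zpow (k : ℤ) : rotationNumber (u ^ k) = k :=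
  CircleDeg1Lift.translationNumber_of_eq_add_int _ (lineAction_u_zpow k 0)

theorem rotationNumber_mul_u_zpow (x : Gtilde) (k : ℤ) :
    rotationNumber (x * u ^ k) = rotationNumber x + k := by
  rw [rotationNumber_mul_of_commute (commute_u_zpow x k), rotationNumber_u_zpow]

/-! ### The set `Ξ` and levels -/

theorem discr_eq_of_cls_eq {A B : SL(2, ℝ)} (h : cls A = cls B) : B.val.discr = A.val.discr := by
  rcases val_eq_or_of_cls_eq h with hAB | hAB <;>
    simp [hAB, Matrix.discr_fin_two, Matrix.det_neg]

theorem cls_mem_Xi_iff {A : SL(2, ℝ)} : cls A ∈ Xi ↔ 0 ≤ A.val.discr := by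
  constructor
  · rintro (⟨B, hBA, hB⟩ | ⟨B, hBA, hB⟩ | hA)
    · exact (discr_eq_of_cls_eq hBA).symm ▸ hB.le
    · exact (discr_eq_of_cls_eq hBA).symm ▸ hB.2.ge
    · rw [discr_eq_of_cls_eq (A := 1) hA.symm]
      norm_num [Matrix.discr_fin_two]
  · intro hdiscr
    by_cases hscalar : A.val ∈ Set.range (Matrix.scalar (Fin 2))
    · obtain ⟨r, hr⟩ := hscalar
      refine .inr (.inr ((QuotientGroup.eq_one_iff A).mpr
        (Matrix.SpecialLinearGroup.mem_center_iff.mpr ⟨r, ?_, hr⟩)))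
      simpa [← hr] using A.det_coe
    · rcases hdiscr.lt_or_eq with hpos | hzero
      · exact .inl ⟨A, rfl, hpos⟩
      · exact .inr (.inl ⟨A, rfl, hscalar, hzero.symm⟩)

theorem exists_planeMap_eq_real_mul {A : Matrix (Fin 2) (Fin 2) ℝ} (hA : 0 ≤ A.discr) :
    ∃ w : ℂ, w ≠ 0 ∧ ∃ r : ℝ, planeMap A w = r * w := by
  obtain ⟨r, hr⟩ : ∃ r : ℝ, 1 * (r * r) + -A.trace * r + A.det = 0 := by
    refine exists_quadratic_eq_zero one_ne_zero ⟨√A.discr, ?_⟩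
    rw [Real.mul_self_sqrt hA, Matrix.discr_fin_two, discrim]
    ring
  have hdet : (A - Matrix.scalar (Fin 2) r).det = 0 := by
    rw [Matrix.trace_fin_two, Matrix.det_fin_two] at hr
    simp only [Matrix.det_fin_two, Matrix.sub_apply, Matrix.scalar_apply, Matrix.diagonal_apply_eq,
      Matrix.diagonal_apply_ne _ zero_ne_one, Matrix.diagonal_apply_ne _ one_ne_zero, sub_zero]
    linarith
  obtain ⟨v, hv, hAv⟩ := Matrix.exists_mulVec_eq_zero_iff.mpr hdet
  refine ⟨⟨v 0, v 1⟩, fun h => hv ?_, r, ?_⟩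
  · ext i
    fin_cases i
    · exact congrArg Complex.re h
    · exact congrArg Complex.im h
  · have h0 := congrFun hAv 0
    have h1 := congrFun hAv 1
    simp only [Matrix.mulVec, dotProduct, Fin.sum_univ_two, Matrix.sub_apply, Matrix.scalar_apply,
      Matrix.diagonal_apply_eq, Matrix.diagonal_apply_ne _ zero_ne_one,
      Matrix.diagonal_apply_ne _ one_ne_zero, sub_zero, Pi.zero_apply] at h0 h1
    exact planeMap_eq_real_mul_iff.mpr ⟨by linarith, by linarith⟩

theorem exists_cls_smul_one_eq (z : Circle) : ∃ R : SL(2, ℝ), cls R • (1 : Circle) = z := by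
  obtain ⟨φ, rfl⟩ := Circle.exp_surjective z
  exact ⟨rotMatrix φ, by rw [cls_rotMatrix_smul, mul_one]⟩

theorem discr_conj_eq (R A : SL(2, ℝ)) : (R⁻¹ * A * R).val.discr = A.val.discr := by
  have htrace : (R⁻¹ * A * R).val.trace = A.val.trace :=
    calc (R⁻¹ * A * R).val.trace = (R * (R⁻¹ * A)).val.trace := Matrix.trace_mul_comm _ _
      _ = A.val.trace := by rw [mul_inv_cancel_left]
  rw [Matrix.discr_fin_two, Matrix.discr_fin_two, Matrix.SpecialLinearGroup.det_coe,
    Matrix.SpecialLinearGroup.det_coe, htrace]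

theorem discr_nonneg_of_apply_one_zero {A : Matrix (Fin 2) (Fin 2) ℝ} (h : A 1 0 = 0) :
    0 ≤ A.discr := by
  rw [Matrix.discr_fin_two, Matrix.trace_fin_two, Matrix.det_fin_two, h]
  nlinarith [sq_nonneg (A 0 0 - A 1 1)]

theorem mem_Xi_iff_exists_smul_eq {x : G} : x ∈ Xi ↔ ∃ z : Circle, x • z = z := by
  obtain ⟨A, rfl⟩ := cls_surjective x
  rw [cls_mem_Xi_iff]
  constructor
  · intro hA
    obtain ⟨w, hw, r, h⟩ := exists_planeMap_eq_real_mul hA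
    exact ⟨_, cls_smul_ofConjDivSelf_of_planeMap_eq hw h⟩
  · rintro ⟨z, hz⟩
    obtain ⟨R, rfl⟩ := exists_cls_smul_one_eq z
    have hfix : cls (R⁻¹ * A * R) • (1 : Circle) = 1 := by
      change ((cls R)⁻¹ * cls A * cls R) • (1 : Circle) = 1
      rw [mul_smul, mul_smul, hz, inv_smul_smul]
    rw [← discr_conj_eq R A]
    exact discr_nonneg_of_apply_one_zero (apply_one_zero_eq_zero_of_cls_smul_one hfix)

theorem cls_upper_smul_one (l b : ℝ) : cls (upper l b) • (1 : Circle) = 1 := by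
  have hone : Circle.ofConjDivSelf 1 one_ne_zero = 1 := Circle.ext (by simp)
  rw [← hone]
  refine cls_smul_ofConjDivSelf_of_planeMap_eq one_ne_zero (r := Real.exp (l / 2)) ?_
  rw [planeMap_eq_real_mul_iff]
  simp [upper]

theorem exists_pathGroup_of_mem_Xi {x : G} (hx : x ∈ Xi) :
    ∃ γ : PathGroup G, (∀ s, (γ : C(I, G)) s ∈ Xi) ∧ (γ : C(I, G)) 1 = x := by
  obtain ⟨z, hz⟩ := mem_Xi_iff_exists_smul_eq.mp hx
  obtain ⟨R, rfl⟩ : ∃ R : G, R • (1 : Circle) = z :=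
    (exists_cls_smul_one_eq z).imp' cls fun _ => id
  have hfix : (R⁻¹ * x * R) • (1 : Circle) = 1 := by
    rw [mul_smul, mul_smul, hz, inv_smul_smul]
  obtain ⟨l, b, hlb⟩ : ∃ l b, cls (upper l b) = R⁻¹ * x * R := ⟨_, _, cls_upper_gram hfix⟩
  refine ⟨⟨⟨fun s => R * cls (upper (s * l) (s * b)) * R⁻¹, ?_⟩, ?_⟩, fun s => ?_, ?_⟩
  · have hupper : Continuous fun s : I => upper (s * l) (s * b) :=
      continuous_upper (by fun_prop) (by fun_prop)
    exact (continuous_const.mul (continuous_cls.comp hupper)).mul continuous_const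
  · change R * cls (upper ((0 : I) * l) ((0 : I) * b)) * R⁻¹ = 1
    rw [Set.Icc.coe_zero, zero_mul, zero_mul, upper_zero_zero]
    exact mul_inv_eq_one.mpr (mul_one R)
  · refine mem_Xi_iff_exists_smul_eq.mpr ⟨R • 1, ?_⟩
    change (R * cls (upper (s * l) (s * b)) * R⁻¹) • R • (1 : Circle) = R • 1
    rw [mul_smul, mul_smul, inv_smul_smul, cls_upper_smul_one]
  · change R * cls (upper ((1 : I) * l) ((1 : I) * b)) * R⁻¹ = x
    rw [Set.Icc.coe_one, one_mul, one_mul, hlb]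
    group

theorem exists_atLevel {x : Gtilde} (hx : UniversalCover.proj G x ∈ Xi) : ∃ k, AtLevel x k := by
  obtain ⟨γ, hγ, hγx⟩ := exists_pathGroup_of_mem_Xi hx
  obtain ⟨k, hk⟩ := exists_eq_u_zpow (x := (QuotientGroup.mk γ)⁻¹ * x) (by
    rw [map_mul, map_inv, ← hγx]
    exact inv_mul_cancel _)
  exact ⟨k, γ, hγ, inv_mul_eq_iff_eq_mul.mp hk⟩

theorem AtLevel.rotationNumber_eq {x : Gtilde} {k : ℤ} (h : AtLevel x k) :
    rotationNumber x = k := by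
  obtain ⟨γ, hγ, rfl⟩ := h
  rw [rotationNumber_mul_u_zpow,
    rotationNumber_mk_eq_zero fun s => mem_Xi_iff_exists_smul_eq.mp (hγ s), zero_add]

theorem rotationNumber_eq_level {x : Gtilde} (hx : UniversalCover.proj G x ∈ Xi) :
    rotationNumber x = level x := by
  rw [level, dif_pos (exists_atLevel hx)]
  exact (exists_atLevel hx).choose_spec.rotationNumber_eq

theorem level_eq_of_rotationNumber_eq {x : Gtilde} (hx : UniversalCover.proj G x ∈ Xi) {k : ℤ}
    (hk : rotationNumber x = k) : level x = k := by
  rw [rotationNumber_eq_level hx] at hk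
  exact_mod_cast hk

theorem inv_mem_Xi {x : G} (hx : x ∈ Xi) : x⁻¹ ∈ Xi := by
  obtain ⟨z, hz⟩ := mem_Xi_iff_exists_smul_eq.mp hx
  exact mem_Xi_iff_exists_smul_eq.mpr ⟨z, inv_smul_eq_iff.mpr hz.symm⟩

theorem conj_mem_Xi_iff {x y : G} : y * x * y⁻¹ ∈ Xi ↔ x ∈ Xi := by
  simp only [mem_Xi_iff_exists_smul_eq, mul_smul]
  constructor
  · rintro ⟨z, hz⟩
    exact ⟨y⁻¹ • z, eq_inv_smul_iff.mpr hz⟩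
  · rintro ⟨z, hz⟩
    exact ⟨y • z, by rw [inv_smul_smul, hz]⟩

theorem level_mul_u_zpow {x : Gtilde} (hx : UniversalCover.proj G x ∈ Xi) (k : ℤ) :
    level (x * u ^ k) = level x + k := by
  refine level_eq_of_rotationNumber_eq ?_ ?_
  · rwa [map_mul, proj_u_zpow, mul_one]
  · rw [rotationNumber_mul_u_zpow, rotationNumber_eq_level hx, Int.cast_add]

theorem level_inv {x : Gtilde} (hx : UniversalCover.proj G x ∈ Xi) : level x⁻¹ = -level x := by
  refine level_eq_of_rotationNumber_eq ?_ ?_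
  · rw [map_inv]
    exact inv_mem_Xi hx
  · rw [rotationNumber_inv, rotationNumber_eq_level hx, Int.cast_neg]

theorem level_conj {x : Gtilde} (hx : UniversalCover.proj G x ∈ Xi) (y : Gtilde) :
    level (y * x * y⁻¹) = level x := by
  refine level_eq_of_rotationNumber_eq ?_ ?_
  · rw [map_mul, map_mul, map_inv]
    exact conj_mem_Xi_iff.mpr hx
  · rw [rotationNumber_conj, rotationNumber_eq_level hx]

theorem lineAction_eq_add_level {x : Gtilde} {t : ℝ}
    (h : UniversalCover.proj G x • turn t = turn t) : lineAction G x t = t + level x := by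
  obtain ⟨k, hk⟩ := turn_eq_turn_iff.mp ((turn_lineAction x t).trans h)
  rw [hk, level_eq_of_rotationNumber_eq (mem_Xi_iff_exists_smul_eq.mpr ⟨_, h⟩)
    ((lineAction G x).translationNumber_of_eq_add_int hk)]

/-! ### Positive elements and sequential triples -/

/-- The coordinate in `(0, 1)` of the real point `α` on the universal cover of the circle, in which
the lifts of `∞` are the integers. -/
def ang (α : ℝ) : ℝ := 1 / 2 + Real.arctan α / Real.pi

theorem ang_pos (α : ℝ) : 0 < ang α := by
  have h : -(1 / 2) < Real.arctan α / Real.pi := by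
    rw [lt_div_iff₀ Real.pi_pos]
    linarith [Real.neg_pi_div_two_lt_arctan α]
  rw [ang]
  linarith

theorem ang_lt_one (α : ℝ) : ang α < 1 := by
  have h : Real.arctan α / Real.pi < 1 / 2 := by
    rw [div_lt_iff₀ Real.pi_pos]
    linarith [Real.arctan_lt_pi_div_two α]
  rw [ang]
  linarith

theorem ang_strictMono : StrictMono ang := fun _ _ h =>
  add_lt_add_right (div_lt_div_of_pos_right (Real.arctan_strictMono h) Real.pi_pos) _

theorem add_I_ne_zero (α : ℝ) : (α + Complex.I : ℂ) ≠ 0 := fun h => by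
  simpa using congrArg Complex.im h

theorem ofConjDivSelf_add_I (α : ℝ) :
    Circle.ofConjDivSelf (α + Complex.I) (add_I_ne_zero α) = turn (ang α) := by
  have hcos := (Real.cos_arctan_pos α).ne'
  have hsin : Real.sin (Real.arctan α) = α * Real.cos (Real.arctan α) := by
    rw [← div_eq_iff hcos, ← Real.tan_eq_sin_div_cos, Real.tan_arctan]
  have hpolar : (Real.cos (Real.arctan α) : ℂ) * (α + Complex.I) =
      Circle.exp (Real.pi / 2 - Real.arctan α) := by
    rw [Circle.coe_exp, Complex.exp_mul_I, ← Complex.ofReal_cos, ← Complex.ofReal_sin,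
      Real.cos_pi_div_two_sub, Real.sin_pi_div_two_sub, hsin]
    push_cast
    ring
  have hne : (Real.cos (Real.arctan α) : ℂ) * (α + Complex.I) ≠ 0 :=
    hpolar ▸ Circle.coe_ne_zero _
  rw [← ofConjDivSelf_real_mul hne]
  simp only [hpolar, ofConjDivSelf_exp]
  rw [← sub_add_cancel (ang α) 1, turn_add_one, turn, ang]
  congr 1
  field_simp
  ring

theorem smul_turn_ang_of_fixesReal {x : G} {α : ℝ} (h : FixesReal x α) :
    x • turn (ang α) = turn (ang α) := by
  obtain ⟨A, rfl, hA⟩ := h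
  rw [← ofConjDivSelf_add_I]
  refine cls_smul_ofConjDivSelf_of_planeMap_eq _ (r := A.val 1 0 * α + A.val 1 1) ?_
  rw [planeMap_eq_real_mul_iff]
  simpa using hA.trans (mul_comm _ _)

theorem cls_smul_one_of_ne_zero {A : SL(2, ℝ)} (hc : A.val 1 0 ≠ 0) :
    cls A • (1 : Circle) = turn (ang (A.val 0 0 / A.val 1 0)) := by
  have hone : Circle.ofConjDivSelf 1 one_ne_zero = 1 := Circle.ext (by simp)
  have hplane : planeMap A.val 1 =
      (A.val 1 0 : ℂ) * (((A.val 0 0 / A.val 1 0 : ℝ) : ℂ) + Complex.I) := by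
    simp [planeMap_eq_real_mul_iff, mul_div_cancel₀ _ hc]
  have hne := hplane ▸ planeMap_ne_zero A one_ne_zero
  rw [← hone, cls_smul_ofConjDivSelf, ← ofConjDivSelf_add_I, ← ofConjDivSelf_real_mul hne]
  simp only [hplane]

theorem IsPositive.exists_fixesReal {x : G} (hx : IsPositive x) :
    ∃ α β, FixesReal x α ∧ β < α ∧ x • (1 : Circle) = turn (ang β) := by
  rcases hx with ⟨α, β, l, hαβ, hl, rfl⟩ | ⟨α, l, hl, rfl⟩
  · have hsqrt : 0 < √l := Real.sqrt_pos.mpr (by linarith)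
    have hscale : 1 / ((α - β) * √l) ≠ 0 :=
      one_div_ne_zero (mul_ne_zero (sub_ne_zero.mpr hαβ.ne) hsqrt.ne')
    refine ⟨α, (l * α - β) / (l - 1), ⟨_, rfl, ?_⟩, ?_, ?_⟩
    · simp only [Matrix.smul_apply, smul_eq_mul, Matrix.of_apply, Matrix.cons_val',
        Matrix.cons_val_zero, Matrix.cons_val_one, Matrix.cons_val_fin_one]
      ring
    · rw [div_lt_iff₀ (by linarith)]
      linarith
    · refine (cls_smul_one_of_ne_zero ?_).trans
        (congrArg (turn ∘ ang) (mul_div_mul_left _ _ hscale))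
      exact mul_ne_zero hscale (sub_ne_zero.mpr hl.ne')
  · refine ⟨α, (1 - l * α) / -l, ⟨_, rfl, ?_⟩, ?_, cls_smul_one_of_ne_zero (by simpa using hl.ne')⟩
    · simp only [Matrix.of_apply, Matrix.cons_val', Matrix.cons_val_zero, Matrix.cons_val_one,
        Matrix.cons_val_fin_one]
      ring
    · rw [div_neg, neg_lt, lt_div_iff₀ hl]
      linarith

theorem IsPositive.mem_Xi {x : G} (hx : IsPositive x) : x ∈ Xi := by
  obtain ⟨α, -, hα, -⟩ := hx.exists_fixesReal
  exact mem_Xi_iff_exists_smul_eq.mpr ⟨_, smul_turn_ang_of_fixesReal hα⟩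

theorem level_lt_lineAction_zero {x : Gtilde} (hx : IsPositive (UniversalCover.proj G x)) :
    level x < lineAction G x 0 := by
  obtain ⟨α, β, hα, hβα, hβ⟩ := hx.exists_fixesReal
  have hfix := lineAction_eq_add_level (smul_turn_ang_of_fixesReal hα)
  obtain ⟨j, hj⟩ : ∃ j : ℤ, lineAction G x 0 = ang β + j :=
    turn_eq_turn_iff.mp (by rw [turn_lineAction, turn_zero, hβ])
  have hmono : lineAction G x (ang α - (1 : ℤ)) < lineAction G x 0 :=
    lineAction_strictMono x (by push_cast; linarith [ang_lt_one α])
  rw [CircleDeg1Lift.map_sub_int, hfix, hj, Int.cast_one] at hmono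
  have hlevel : level x < j + 1 := by
    exact_mod_cast (by linarith [ang_strictMono hβα] : (level x : ℝ) < j + 1)
  have hle : (level x : ℝ) ≤ j := Int.cast_le.mpr (Int.lt_add_one_iff.mp hlevel)
  linarith [ang_pos β]

theorem exists_fixesReal_lineAction_ang {x : Gtilde} (hx : IsPositive (UniversalCover.proj G x)) :
    ∃ α, FixesReal (UniversalCover.proj G x) α ∧ lineAction G x (ang α) = ang α + level x := by
  obtain ⟨α, -, hα, -⟩ := hx.exists_fixesReal
  exact ⟨α, hα, lineAction_eq_add_level (smul_turn_ang_of_fixesReal hα)⟩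

section IsPositive

variable {x y z : Gtilde} (hx : IsPositive (UniversalCover.proj G x))
  (hy : IsPositive (UniversalCover.proj G y)) (hz : IsPositive (UniversalCover.proj G z))

include hx hy hz

theorem level_add_level_add_level_lt_lineAction_zero :
    level x + level y + level z < lineAction G (x * y * z) 0 := by
  have hyz : lineAction G y (0 + level z) < lineAction G y (lineAction G z 0) :=
    lineAction_strictMono y (by simpa using level_lt_lineAction_zero hz)
  rw [CircleDeg1Lift.map_add_int] at hyz
  have hxyz : lineAction G x (0 + ↑(level y + level z)) <
      lineAction G x (lineAction G y (lineAction G z 0)) := by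
    refine lineAction_strictMono x ?_
    push_cast
    linarith [level_lt_lineAction_zero hy]
  rw [CircleDeg1Lift.map_add_int] at hxyz
  push_cast at hxyz
  rw [map_mul, map_mul, CircleDeg1Lift.mul_apply, CircleDeg1Lift.mul_apply]
  linarith [level_lt_lineAction_zero hx]

theorem exists_lineAction_lt_of_fixLT
    (hxy : FixLT (UniversalCover.proj G x) (UniversalCover.proj G y))
    (hyz : FixLT (UniversalCover.proj G y) (UniversalCover.proj G z)) :
    ∃ t, lineAction G (y * z * x) t < t + (level x + level y + level z + 2) := by
  obtain ⟨α, hα, hxα⟩ := exists_fixesReal_lineAction_ang hx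
  obtain ⟨β, hβ, hyβ⟩ := exists_fixesReal_lineAction_ang hy
  obtain ⟨δ, hδ, hzδ⟩ := exists_fixesReal_lineAction_ang hz
  have hzα : lineAction G z (ang α) < lineAction G z (ang δ) :=
    lineAction_strictMono z (ang_strictMono ((hxy α β hα hβ).trans (hyz β δ hβ hδ)))
  have hyzα : lineAction G y (lineAction G z (ang α + level x)) <
      lineAction G y (ang β + ↑(1 + level z + level x)) := by
    refine lineAction_strictMono y ?_
    rw [CircleDeg1Lift.map_add_int]
    push_cast
    linarith [ang_lt_one δ, ang_pos β]
  refine ⟨ang α, ?_⟩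
  rw [map_mul, map_mul, CircleDeg1Lift.mul_apply, CircleDeg1Lift.mul_apply, hxα]
  rw [(lineAction G y).map_add_int (ang β), hyβ] at hyzα
  push_cast at hyzα
  linarith [ang_lt_one β, ang_pos α]

theorem mul_mul_eq_u_zpow_of_fixLT
    (hxy : FixLT (UniversalCover.proj G x) (UniversalCover.proj G y))
    (hyz : FixLT (UniversalCover.proj G y) (UniversalCover.proj G z))
    (hone : UniversalCover.proj G (x * y * z) = 1) :
    x * y * z = u ^ (level x + level y + level z + 1) := by
  obtain ⟨k, hk⟩ := exists_eq_u_zpow hone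
  have hcyc : y * z * x = u ^ k := by
    rw [← mul_right_inj x, ← mul_assoc, ← mul_assoc, hk]
    exact (commute_u_zpow x k).eq.symm
  have hlow := level_add_level_add_level_lt_lineAction_zero hx hy hz
  obtain ⟨t, hup⟩ := exists_lineAction_lt_of_fixLT hx hy hz hxy hyz
  rw [hk, lineAction_u_zpow, zero_add] at hlow
  rw [hcyc, lineAction_u_zpow, add_lt_add_iff_left] at hup
  have hlow' : level x + level y + level z < k := by exact_mod_cast hlow
  have hup' : k < level x + level y + level z + 2 := by exact_mod_cast hup
  rw [hk, show k = level x + level y + level z + 1 by lia]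

end IsPositive

theorem IsSequentialTriple.mem_Xi {x y z : G} (h : IsSequentialTriple x y z) :
    x ∈ Xi ∧ y ∈ Xi ∧ z ∈ Xi := by
  obtain ⟨-, a, hx, hy, hz, -⟩ := h
  exact ⟨conj_mem_Xi_iff.mp hx.mem_Xi, conj_mem_Xi_iff.mp hy.mem_Xi, conj_mem_Xi_iff.mp hz.mem_Xi⟩

theorem IsSequentialTriple.mul_eq {x y z : Gtilde}
    (h : IsSequentialTriple (UniversalCover.proj G x) (UniversalCover.proj G y)
      (UniversalCover.proj G z)) : x * y * z = u ^ (level x + level y + level z + 1) := by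
  obtain ⟨hxΞ, hyΞ, hzΞ⟩ := h.mem_Xi
  obtain ⟨hone, a, hx, hy, hz, hxy, hyz⟩ := h
  obtain ⟨a, rfl⟩ := proj_surjective a
  simp only [← map_inv, ← map_mul] at hone hx hy hz hxy hyz
  have hconj : a * x * a⁻¹ * (a * y * a⁻¹) * (a * z * a⁻¹) = a * (x * y * z) * a⁻¹ := by group
  have hprod := mul_mul_eq_u_zpow_of_fixLT hx hy hz hxy hyz (by
    rw [hconj, map_mul, map_mul, hone, mul_one, map_inv, mul_inv_cancel])
  rw [level_conj hxΞ, level_conj hyΞ, level_conj hzΞ, hconj, mul_inv_eq_iff_eq_mul] at hprod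
  exact mul_left_cancel (hprod.trans (commute_u_zpow a _).eq.symm)

theorem IsSequentialTriple.level_mul {x y : Gtilde} {C : G}
    (h : IsSequentialTriple (UniversalCover.proj G x) (UniversalCover.proj G y) C) :
    level (x * y) = level x + level y + 1 := by
  obtain ⟨z, rfl⟩ := proj_surjective C
  obtain ⟨-, -, hz⟩ := h.mem_Xi
  have hinv : UniversalCover.proj G z⁻¹ ∈ Xi := by
    rw [map_inv]
    exact inv_mem_Xi hz
  rw [← mul_inv_cancel_right (x * y) z, h.mul_eq, ← (commute_u_zpow z⁻¹ _).eq,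
    level_mul_u_zpow hinv, level_inv hz]
  ring

/-! ### Products of lifts of sequential sets -/

theorem IsSequentialGenusZero.triple {lh lp : ℕ} {L R : List Gtilde} {x : Gtilde}
    (h : IsSequentialGenusZero lh lp ((L ++ x :: R).map (UniversalCover.proj G))) (hL : L ≠ [])
    (hR : R ≠ []) :
    IsSequentialTriple (UniversalCover.proj G L.prod) (UniversalCover.proj G x)
      (UniversalCover.proj G R.prod) := by
  rw [map_list_prod, map_list_prod]
  exact h.2.2.2 _ _ _ (by rw [List.map_append, List.map_cons]) (by simpa using hL)
    (by simpa using hR)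

theorem IsSequentialGenusZero.level_prod {lh lp : ℕ} {L R : List Gtilde}
    (h : IsSequentialGenusZero lh lp ((L ++ R).map (UniversalCover.proj G))) (hL : L ≠ [])
    (hR : R ≠ []) : level L.prod = (L.map level).sum + L.length - 1 := by
  induction L using List.reverseRecOn generalizing R with
  | nil => exact absurd rfl hL
  | append_singleton L x ih =>
    rcases eq_or_ne L [] with rfl | hL'
    · simp
    · rw [List.append_assoc, List.singleton_append] at h
      rw [List.prod_append, List.prod_singleton, (h.triple hL' hR).level_mul,
        ih h hL' (List.cons_ne_nil x R), List.map_append, List.sum_append, List.length_append,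
        List.map_singleton, List.sum_singleton, List.length_singleton]
      push_cast
      ring

theorem IsSequentialGenusZero.prod_eq_u_zpow {lh lp : ℕ} {xs : List Gtilde}
    (h : IsSequentialGenusZero lh lp (xs.map (UniversalCover.proj G))) (hlen : 3 ≤ xs.length) :
    xs.prod = u ^ ((xs.map level).sum + xs.length - 2) := by
  obtain ⟨L, x, z, rfl⟩ : ∃ L x z, xs = L ++ [x, z] := by
    rcases xs.eq_nil_or_concat with rfl | ⟨ys, z, rfl⟩
    · simp at hlen
    rcases ys.eq_nil_or_concat with rfl | ⟨L, x, rfl⟩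
    · simp at hlen
    exact ⟨L, x, z, by simp⟩
  have hL : L ≠ [] := by
    rintro rfl
    simp at hlen
  have hprod := (h.triple hL (List.cons_ne_nil z [])).mul_eq
  rw [h.level_prod hL (List.cons_ne_nil x [z]), List.prod_singleton] at hprod
  rw [List.prod_append, List.prod_cons, List.prod_singleton, ← mul_assoc, hprod]
  congr 1
  simp only [List.map_append, List.map_cons, List.map_nil, List.sum_append, List.sum_cons,
    List.sum_nil, List.length_append, List.length_cons, List.length_nil]
  push_cast
  ring

theorem level_add_level_conj_inv {x : Gtilde} (hx : UniversalCover.proj G x ∈ Xi) (y : Gtilde) :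
    level x + level (y * x⁻¹ * y⁻¹) = 0 := by
  have hinv : UniversalCover.proj G x⁻¹ ∈ Xi := by
    rw [map_inv]
    exact inv_mem_Xi hx
  rw [level_conj hinv, level_inv hx, add_neg_cancel]

theorem IsSequential.prod_eq_u_zpow {g lh lp : ℕ} (hn : 3 ≤ 2 * g + lh + lp)
    {a b : Fin g → Gtilde} {c : Fin (lh + lp) → Gtilde}
    (h : IsSequential g lh lp (fun i => UniversalCover.proj G (a i))
      (fun i => UniversalCover.proj G (b i)) fun i => UniversalCover.proj G (c i)) :
    (List.ofFn fun i => a i * b i * (a i)⁻¹ * (b i)⁻¹).prod * (List.ofFn c).prod =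
      u ^ (∑ i, level (c i) + (2 * g + lh + lp) - 2) := by
  obtain ⟨hhyp, -, -, -, hseq⟩ := h
  let xs := (List.ofFn fun i => [a i, b i * (a i)⁻¹ * (b i)⁻¹]).flatten ++ List.ofFn c
  have hmap : xs.map (UniversalCover.proj G) = (List.ofFn fun i => [UniversalCover.proj G (a i),
      UniversalCover.proj G (b i) * (UniversalCover.proj G (a i))⁻¹ *
        (UniversalCover.proj G (b i))⁻¹]).flatten ++
      List.ofFn fun i => UniversalCover.proj G (c i) := by
    simp [xs, List.map_flatten, List.map_ofFn, Function.comp_def]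
  have hlen : xs.length = 2 * g + lh + lp := by
    simp [xs, List.length_flatten, List.map_ofFn, Function.comp_def, mul_comm, add_assoc]
  have hprod : xs.prod =
      (List.ofFn fun i => a i * b i * (a i)⁻¹ * (b i)⁻¹).prod * (List.ofFn c).prod := by
    simp [xs, List.prod_flatten, List.map_ofFn, Function.comp_def, mul_assoc]
  have hcancel (i : Fin g) : level (a i) + level (b i * (a i)⁻¹ * (b i)⁻¹) = 0 :=
    level_add_level_conj_inv (.inl (hhyp i)) (b i)
  have hlevel : (xs.map level).sum = ∑ i, level (c i) := by
    simp [xs, List.map_flatten, List.sum_flatten, List.map_ofFn, Function.comp_def, hcancel,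
      List.sum_ofFn]
  rw [← hmap] at hseq
  rw [← hprod, hseq.prod_eq_u_zpow (by rwa [hlen]), hlevel, hlen]
  push_cast
  rfl

theorem proj_out {m : ℕ} (x : Gm m) : UniversalCover.proj G (Quotient.out x) = Gm.proj m x := by
  conv_rhs => rw [← QuotientGroup.out_eq' x]
  rfl

end LevelLift

end

open LevelLift in
theorem mainTheorem9 (m : ℕ) (hm : 0 < m) (g lh lp : ℕ) (hn : 3 ≤ 2 * g + lh + lp)
    (A B : Fin g → LevelLift.Gm m) (C : Fin (lh + lp) → LevelLift.Gm m)
    (hV : LevelLift.IsSequential g lh lp (fun i => LevelLift.Gm.proj m (A i))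
      (fun i => LevelLift.Gm.proj m (B i)) (fun i => LevelLift.Gm.proj m (C i))) :
    (List.ofFn fun i => A i * B i * (A i)⁻¹ * (B i)⁻¹).prod * (List.ofFn C).prod = 1 ↔
      ∑ i, LevelLift.lev m (C i) =
        (2 - 2 * (g : ZMod m)) - ((lh : ZMod m) + (lp : ZMod m)) := by
  simp only [← proj_out] at hV
  have hprod : (List.ofFn fun i => A i * B i * (A i)⁻¹ * (B i)⁻¹).prod * (List.ofFn C).prod =
      QuotientGroup.mk' (mCenter m) (u ^ (∑ i, level (C i).out + (2 * g + lh + lp) - 2)) := by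
    rw [← hV.prod_eq_u_zpow hn]
    simp only [map_mul, map_inv, map_list_prod, List.map_ofFn, Function.comp_def,
      QuotientGroup.mk'_apply, QuotientGroup.out_eq']
  rw [hprod, QuotientGroup.mk'_apply, QuotientGroup.eq_one_iff, u_zpow_mem_mCenter_iff,
    ← ZMod.intCast_zmod_eq_zero_iff_dvd]
  push_cast
  simp only [lev]
  constructor <;> intro h <;> linear_combination h
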